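/- **Conventions.** A (concrete) operator system is a closed self-adjoint complex linear subspace $X$, containing the unit, of a unital $C^*$-algebra $A$; $X_{\mathrm{sa}}$ denotes its real subspace of self-adjoint elements, and $M_m(X)$ is ordered as a subspace of the $C^*$-algebra $M_m(A)$. A linear map between operator systems is *u.c.p.* if it is unital and all its amplifications $M_m(X)\to M_m(Y)$, $m\ge 1$, are positive. $M_k$ ($k\geq 1$) is the $C^*$-algebra of complex $k\times k$ matrices, and $UCP_n(X)$ is the set of u.c.p. maps $X\to M_n$. The operator system $X$ is *nuclear* if $\mathrm{id}_X$ lies in the point-norm closure of the set of maps $X\to X$ of the form $\Gamma\circ\Phi$ with $\Phi:X\to M_k$ and $\Gamma:M_k\to X$ u.c.p. for some $k\ge 1$. A *Lip-norm* on a real linear unital subspace $D$ of the self-adjoint part of a unital $C^*$-algebra is a semi-norm $L$ on $D$ such that (1) $L(a)=0$ if and only if $a\in\mathbb R 1$, and (2) the metric $\rho_L(\mu,\nu)=\sup\{|\mu(a)-\nu(a)|:a\in D,\ L(a)\le 1\}$ induces the weak$^*$ topology on the set of states (positive unital real linear functionals) of $D$. A *Lip-normed operator system* $(X,L)$ is an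 operator system $X$ with a Lip-norm $L$ on a dense real linear unital subspace $\mathcal D(L)$ of $X_{\mathrm{sa}}$ such that $\mathcal D_1(L)=\{a\in\mathcal D(L):L(a)\le 1\}$ is closed in $X_{\mathrm{sa}}$. For $n\ge1$ put $\rho_{L,n}(\varphi,\psi)=\sup_{x\in\mathcal D_1(L)}\|\varphi(x)-\psi(x)\|$ for $\varphi,\psi\in UCP_n(X)$. For Lip-normed operator systems $(X,L_X)$ and $(Y,L_Y)$, let $\mathcal M(L_X,L_Y)$ be the set of Lip-norms $L$ on $\mathcal D(L_X)\oplus\mathcal D(L_Y)$ making $X\oplus Y$ a Lip-normed operator system and inducing $L_X$ and $L_Y$, that is, $L_X(x)=\inf_{y\in\mathcal D(L_Y)}L(x,y)$ for all $x\in\mathcal D(L_X)$ and $L_Y(y)=\inf_{x\in\mathcal D(L_X)}L(x,y)$ for all $y\in\mathcal D(L_Y)$. The *complete distance* is $$\mathrm{dist}_s(X,Y)=\inf_{L\in\mathcal M(L_X,L_Y)}\ \sup_{n\ge 1}\ \mathrm{dist}_H^{\rho_{L,n}}(UCP_n(X),UCP_n(Y)),$$ where $\mathrm{dist}_H^{\rho_{L,n}}$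 is the Hausdorff distance for $\rho_{L,n}$ in $UCP_n(X\oplus Y)$, and $UCP_n(X)$ and $UCP_n(Y)$ are embedded in $UCP_n(X\oplus Y)$ by composition with the two coordinate projections. **Proposition.** Let $(X,L_X)$ be a Lip-normed nuclear operator system. Then for every $\varepsilon>0$ there exist $k\ge1$ and a Lip-normed operator system $(Y,L_Y)$ such that $Y$ is an operator subsystem of the matrix algebra $M_k$ (that is, a self-adjoint linear subspace of $M_k$ containing the unit) and $\mathrm{dist}_s(X,Y)\le\varepsilon$. -/

import Mathlib

open scoped ComplexOrder ENNReal

noncomputable section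

namespace LipNormed

/-! ### Operator systems and u.c.p. maps -/

/-- A (concrete) operator system: a closed unital self-adjoint complex linear subspace of a unital
C⋆-algebra `A`. -/
structure OperatorSystem (A : Type*) [CStarAlgebra A] extends Submodule ℂ A where
  one_mem' : (1 : A) ∈ carrier
  star_mem' : ∀ x ∈ carrier, star x ∈ carrier
  isClosed' : IsClosed carrier

namespace OperatorSystem

instance {A : Type*} [CStarAlgebra A] : CoeSort (OperatorSystem A) (Type _) :=
  ⟨fun X => X.toSubmodule⟩

/-- The unit of an operator system. -/
def unit {A : Type*} [CStarAlgebra A] (X : OperatorSystem A) : X := ⟨1, X.one_mem'⟩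

/-- A unital C⋆-algebra regarded as an operator system. -/
def full (A : Type*) [CStarAlgebra A] : OperatorSystem A where
  toSubmodule := ⊤
  one_mem' := trivial
  star_mem' _ _ := trivial
  isClosed' := isClosed_univ

/-- The direct sum `X ⊕ Y`, an operator system in the C⋆-algebra `A ⊕ B` (with the maximum norm and
the componentwise operations). -/
def prod {A B : Type*} [CStarAlgebra A] [CStarAlgebra B]
    (X : OperatorSystem A) (Y : OperatorSystem B) : OperatorSystem (A × B) where
  toSubmodule := X.toSubmodule.prod Y.toSubmodule
  one_mem' := ⟨X.one_mem', Y.one_mem'⟩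
  star_mem' _ hx := ⟨X.star_mem' _ hx.1, Y.star_mem' _ hx.2⟩
  isClosed' := X.isClosed'.prod Y.isClosed'

/-- The projection `X ⊕ Y → X`. -/
def fst {A B : Type*} [CStarAlgebra A] [CStarAlgebra B]
    (X : OperatorSystem A) (Y : OperatorSystem B) : X.prod Y →ₗ[ℂ] X where
  toFun z := ⟨(z : A × B).1, z.2.1⟩
  map_add' _ _ := rfl
  map_smul' _ _ := rfl

/-- The projection `X ⊕ Y → Y`. -/
def snd {A B : Type*} [CStarAlgebra A] [CStarAlgebra B]
    (X : OperatorSystem A) (Y : OperatorSystem B) : X.prod Y →ₗ[ℂ] Y where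
  toFun z := ⟨(z : A × B).2, z.2.2⟩
  map_add' _ _ := rfl
  map_smul' _ _ := rfl

end OperatorSystem

/-- The C⋆-algebra `M_n` of complex `n × n` matrices (with its C⋆-norm). -/
abbrev Mat (n : ℕ) : Type := CStarMatrix (Fin n) (Fin n) ℂ

section Maps

variable {A B C : Type*}
  [CStarAlgebra A] [PartialOrder A] [StarOrderedRing A]
  [CStarAlgebra B] [PartialOrder B] [StarOrderedRing B]
  [CStarAlgebra C] [PartialOrder C] [StarOrderedRing C]

/-- A linear map `φ : X → Y` of operator systems is unital completely positive: it is unital and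
every amplification `M_m(X) → M_m(Y)` is positive, where the positive elements of `M_m(X)` are those
that are positive in `M_m(A)`. -/
structure IsUCP {X : OperatorSystem A} {Y : OperatorSystem B} (φ : X →ₗ[ℂ] Y) : Prop where
  map_unit : φ X.unit = Y.unit
  map_nonneg : ∀ (m : ℕ) (M : CStarMatrix (Fin m) (Fin m) X),
    0 ≤ M.map (fun x => (x : A)) → 0 ≤ M.map (fun x => ((φ x : Y) : B))

theorem IsUCP.comp {X : OperatorSystem A} {Y : OperatorSystem B} {Z : OperatorSystem C}
    {ψ : Y →ₗ[ℂ] Z} {φ : X →ₗ[ℂ] Y} (hψ : IsUCP ψ) (hφ : IsUCP φ) : IsUCP (ψ ∘ₗ φ) where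
  map_unit := by simp [hφ.map_unit, hψ.map_unit]
  map_nonneg m M hM := hψ.map_nonneg m (M.map φ) (hφ.map_nonneg m M hM)

theorem isUCP_fst (X : OperatorSystem A) (Y : OperatorSystem B) : IsUCP (X.fst Y) where
  map_unit := rfl
  map_nonneg m _ hM :=
    map_nonneg (CStarMatrix.mapₙₐ (n := Fin m) (NonUnitalStarAlgHom.fst ℂ A B)) hM

theorem isUCP_snd (X : OperatorSystem A) (Y : OperatorSystem B) : IsUCP (X.snd Y) where
  map_unit := rfl
  map_nonneg m _ hM :=
    map_nonneg (CStarMatrix.mapₙₐ (n := Fin m) (NonUnitalStarAlgHom.snd ℂ A B)) hM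

/-- An operator system is nuclear if its identity map lies in the point-norm closure of the set of
u.c.p. maps `X → M_k → X` factoring through matrix algebras (the point-norm topology on maps
`X → X` is the product topology). -/
def IsNuclear (X : OperatorSystem A) : Prop :=
  (id : X → X) ∈ closure {f : X → X | ∃ k : ℕ, 0 < k ∧
    ∃ (Φ : X →ₗ[ℂ] OperatorSystem.full (Mat k)) (Γ : OperatorSystem.full (Mat k) →ₗ[ℂ] X),
      IsUCP Φ ∧ IsUCP Γ ∧ f = Γ ∘ Φ}

/-- The matrix state space `UCP_n(X)`: the u.c.p. maps `X → M_n`. -/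
def UCP (X : OperatorSystem A) (n : ℕ) : Type _ :=
  {φ : X →ₗ[ℂ] OperatorSystem.full (Mat n) // IsUCP φ}

/-- The value in `M_n` of `φ ∈ UCP_n(X)` at `x ∈ X`. -/
def UCP.eval {X : OperatorSystem A} {n : ℕ} (φ : UCP X n) (x : X) : Mat n := (φ.1 x : Mat n)

/-- The canonical map `UCP_n(X) → UCP_n(X ⊕ Y)`. -/
def UCP.inl {X : OperatorSystem A} (Y : OperatorSystem B) {n : ℕ} (φ : UCP X n) :
    UCP (X.prod Y) n :=
  ⟨φ.1 ∘ₗ X.fst Y, φ.2.comp (isUCP_fst X Y)⟩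

/-- The canonical map `UCP_n(Y) → UCP_n(X ⊕ Y)`. -/
def UCP.inr (X : OperatorSystem A) {Y : OperatorSystem B} {n : ℕ} (φ : UCP Y n) :
    UCP (X.prod Y) n :=
  ⟨φ.1 ∘ₗ X.snd Y, φ.2.comp (isUCP_snd X Y)⟩

end Maps

/-! ### Lip-norms -/

/-- An order-unit space of self-adjoint elements: a real linear unital subspace of the self-adjoint
part of a unital C⋆-algebra. Its order is the one of the C⋆-algebra and its order unit is `1`. -/
structure OrderUnitSubspace (A : Type*) [CStarAlgebra A] extends Submodule ℝ A where
  one_mem' : (1 : A) ∈ carrier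
  isSelfAdjoint' : ∀ a ∈ carrier, IsSelfAdjoint a

namespace OrderUnitSubspace

instance {A : Type*} [CStarAlgebra A] : CoeSort (OrderUnitSubspace A) (Type _) :=
  ⟨fun D => D.toSubmodule⟩

/-- The order unit. -/
def unit {A : Type*} [CStarAlgebra A] (D : OrderUnitSubspace A) : D := ⟨1, D.one_mem'⟩

/-- The state space of an order-unit space: the positive unital real linear functionals. -/
def State {A : Type*} [CStarAlgebra A] [PartialOrder A] (D : OrderUnitSubspace A) : Type _ :=
  {μ : D →ₗ[ℝ] ℝ // (∀ a : D, 0 ≤ (a : A) → 0 ≤ μ a) ∧ μ D.unit = 1}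

/-- The weak⋆ topology on the state space, that is, the topology of pointwise convergence. -/
@[reducible] def weakStar {A : Type*} [CStarAlgebra A] [PartialOrder A] (D : OrderUnitSubspace A) :
    TopologicalSpace D.State :=
  TopologicalSpace.induced (fun (μ : D.State) (a : D) => μ.1 a) inferInstance

/-- The metric `ρ_L(μ, ν) = sup {|μ(a) - ν(a)| : L(a) ≤ 1}` on the state space, a priori with values
in `[0, ∞]`. -/
@[reducible] def rho {A : Type*} [CStarAlgebra A] [PartialOrder A] (D : OrderUnitSubspace A)
    (L : Seminorm ℝ D) : PseudoEMetricSpace D.State where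
  edist μ ν := ⨆ (a : D) (_ : L a ≤ 1), edist (μ.1 a) (ν.1 a)
  edist_self μ := by simp
  edist_comm μ ν := by simp only [edist_comm]
  edist_triangle μ ν ξ := iSup₂_le fun a ha =>
    (edist_triangle _ (ν.1 a) _).trans <| add_le_add
      (le_iSup₂ (f := fun (a : D) (_ : L a ≤ 1) => edist (μ.1 a) (ν.1 a)) a ha)
      (le_iSup₂ (f := fun (a : D) (_ : L a ≤ 1) => edist (ν.1 a) (ξ.1 a)) a ha)

/-- A seminorm on an order-unit space is a Lip-norm if its null space consists of the scalar
multiples of the order unit and `ρ_L` induces the weak⋆ topology on the state space. (The state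
space being weak⋆ compact, Hausdorff and connected, `ρ_L` is then automatically a finite metric.) -/
structure IsLipNorm {A : Type*} [CStarAlgebra A] [PartialOrder A] (D : OrderUnitSubspace A)
    (L : Seminorm ℝ D) : Prop where
  eq_zero_iff : ∀ a : D, L a = 0 ↔ ∃ t : ℝ, a = t • D.unit
  topology_eq : (D.rho L).toUniformSpace.toTopologicalSpace = D.weakStar

end OrderUnitSubspace

/-- The data turning an operator system `X` into a Lip-normed operator system: a Lip-norm `L` on a
dense order-unit subspace `𝒟(L)` of `X_sa` such that `𝒟₁(L) = {a ∈ 𝒟(L) : L(a) ≤ 1}` is closed in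
`X_sa` (equivalently in `A`, since `X_sa` is closed). -/
structure LipNorm {A : Type*} [CStarAlgebra A] [PartialOrder A] (X : OperatorSystem A) where
  domain : OrderUnitSubspace A
  domain_le : ∀ a ∈ domain.toSubmodule, a ∈ X.toSubmodule
  dense : ∀ x ∈ X.toSubmodule, IsSelfAdjoint x → x ∈ closure (domain.carrier : Set A)
  L : Seminorm ℝ domain
  isLipNorm : domain.IsLipNorm L
  isClosed_unitBall : IsClosed {a : A | ∃ d : domain, (d : A) = a ∧ L d ≤ 1}

namespace LipNorm

section

variable {A : Type*} [CStarAlgebra A] [PartialOrder A] [StarOrderedRing A] {X : OperatorSystem A}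

/-- An element of the domain of a Lip-norm on `X`, as an element of `X`. -/
def incl (LX : LipNorm X) (a : LX.domain) : X := ⟨a, LX.domain_le a a.2⟩

/-- The metric `ρ_{L,n}(φ, ψ) = sup {‖φ(x) - ψ(x)‖ : x ∈ 𝒟₁(L)}` on `UCP_n(X)`. -/
@[reducible] def rho (LX : LipNorm X) (n : ℕ) : PseudoEMetricSpace (UCP X n) where
  edist φ ψ := ⨆ (a : LX.domain) (_ : LX.L a ≤ 1),
    ‖φ.eval (LX.incl a) - ψ.eval (LX.incl a)‖ₑ
  edist_self φ := by simp
  edist_comm φ ψ := by simp only [← edist_eq_enorm_sub, edist_comm]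
  edist_triangle φ ψ χ := iSup₂_le fun a ha => by
    refine le_trans ?_ (add_le_add
      (le_iSup₂ (f := fun (a : LX.domain) (_ : LX.L a ≤ 1) =>
        ‖φ.eval (LX.incl a) - ψ.eval (LX.incl a)‖ₑ) a ha)
      (le_iSup₂ (f := fun (a : LX.domain) (_ : LX.L a ≤ 1) =>
        ‖ψ.eval (LX.incl a) - χ.eval (LX.incl a)‖ₑ) a ha))
    simp only [← edist_eq_enorm_sub]
    exact edist_triangle _ _ _

end

variable {A B : Type*}
  [CStarAlgebra A] [PartialOrder A] [StarOrderedRing A]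
  [CStarAlgebra B] [PartialOrder B] [StarOrderedRing B]
  {X : OperatorSystem A} {Y : OperatorSystem B}

/-- `L ∈ ℳ(L_X, L_Y)`: the (closed) Lip-norm `L` has domain `𝒟(L_X) ⊕ 𝒟(L_Y)` and induces `L_X` and
`L_Y` via the quotient maps, i.e. `L_X(x) = inf {L(x, y) : y ∈ 𝒟(L_Y)}` and
`L_Y(y) = inf {L(x, y) : x ∈ 𝒟(L_X)}`. -/
structure Induces (L : LipNorm (X.prod Y)) (LX : LipNorm X) (LY : LipNorm Y) : Prop where
  mem_domain_iff : ∀ p : A × B, p ∈ L.domain.toSubmodule ↔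
    p.1 ∈ LX.domain.toSubmodule ∧ p.2 ∈ LY.domain.toSubmodule
  fst : ∀ x : LX.domain,
    IsGLB {r : ℝ | ∃ p : L.domain, (p : A × B).1 = x ∧ L.L p = r} (LX.L x)
  snd : ∀ y : LY.domain,
    IsGLB {r : ℝ | ∃ p : L.domain, (p : A × B).2 = y ∧ L.L p = r} (LY.L y)

/-- The Hausdorff distance between `UCP_n(X)` and `UCP_n(Y)`, regarded as subsets of `UCP_n(X ⊕ Y)`,
with respect to `ρ_{L,n}`. -/
def hausdorffDist (L : LipNorm (X.prod Y)) (n : ℕ) : ℝ≥0∞ :=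
  letI := L.rho n
  Metric.hausdorffEDist
    (Set.range (UCP.inl Y : UCP X n → UCP (X.prod Y) n))
    (Set.range (UCP.inr X : UCP Y n → UCP (X.prod Y) n))

/-- The complete distance `dist_s(X, Y)`: the infimum over `L ∈ ℳ(L_X, L_Y)` of the supremum over
`n ≥ 1` of the Hausdorff distances with respect to `ρ_{L,n}`. -/
def completeDist (LX : LipNorm X) (LY : LipNorm Y) : ℝ≥0∞ :=
  ⨅ (L : LipNorm (X.prod Y)) (_ : L.Induces LX LY), ⨆ (n : ℕ) (_ : 0 < n), L.hausdorffDist n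

end LipNorm

end LipNormed

end

/-!
A nuclear operator system `X` has u.c.p. maps `Φ : X → M_k` and `Γ : M_k → X` with `Γ ∘ Φ` close to
the identity on any given finite set. Rieffel's criterion says that a seminorm `L` vanishing exactly
on the scalars is a Lip-norm if and only if its unit ball is totally bounded modulo scalars
(`OrderUnitSubspace.IsLipNorm.exists_totallyBounded` and
`OrderUnitSubspace.isLipNorm_of_totallyBounded`). As u.c.p. maps fix the unit and are contractive on
self-adjoint elements, `Γ ∘ Φ` can therefore be chosen within `ε` of the identity on the whole
Lipschitz ball of `L_X` (`IsNuclear.exists_isUCP_forall_lipschitzBall`).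

Take `Y = Φ(X) ⊆ M_k` with the quotient seminorm `L_Y(y) = inf {L_X(x) : Φ(x) = y}`, a Lip-norm
by Rieffel's criterion (`LipNorm.range`), and on `X ⊕ Y` the seminorm
`L(x, y) = max (L_X(x), L_Y(y), ε⁻¹ ‖Φ(x) - y‖)`. It is a Lip-norm, again by Rieffel's criterion
(`bridge`), and it induces `L_X` and `L_Y` since `L(x, Φ(x)) = L_X(x)` (`bridge_induces`). If
`L(x, y) ≤ 1`, then `‖Φ(x) - y‖ ≤ ε` and `‖x - Γ(y)‖ ≤ 2ε`, so that the matrix states `ψ` of `Y` and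
`ψ ∘ Φ` of `X`, as well as `ψ` of `X` and `ψ ∘ Γ` of `Y`, are within `2ε` of each other, for all
matrix sizes simultaneously (`hausdorffDist_bridge_le`).
-/

open scoped ComplexOrder ENNReal

noncomputable section

namespace LipNormed

/-! ### Rieffel's criterion for Lip-norms -/

section Order

variable {A : Type*} [CStarAlgebra A] [PartialOrder A] [StarOrderedRing A]

theorem smul_one_sub_nonneg {a : A} (ha : IsSelfAdjoint a) {r : ℝ} (hr : ‖a‖ ≤ r) :
    0 ≤ r • (1 : A) - a := by
  have h1 : a ≤ algebraMap ℝ A ‖a‖ := ha.le_algebraMap_norm_self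
  have h2 : algebraMap ℝ A ‖a‖ ≤ algebraMap ℝ A r := algebraMap_mono A hr
  rw [← Algebra.algebraMap_eq_smul_one]
  exact sub_nonneg.2 (h1.trans h2)

theorem norm_le_of_smul_one_sub_nonneg {a : A} (ha : IsSelfAdjoint a) {r : ℝ} (hr : 0 ≤ r)
    (h₁ : 0 ≤ r • (1 : A) - a) (h₂ : 0 ≤ r • (1 : A) + a) : ‖a‖ ≤ r := by
  rcases subsingleton_or_nontrivial A with _ | _
  · rw [Subsingleton.elim a 0, norm_zero]; exact hr
  rw [← Algebra.algebraMap_eq_smul_one] at h₁ h₂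
  rcases CStarAlgebra.norm_or_neg_norm_mem_spectrum ha with h | h
  · exact (le_algebraMap_iff_spectrum_le (R := ℝ) ha).1 (sub_nonneg.1 h₁) _ h
  · have h₃ : algebraMap ℝ A (-r) ≤ a := by
      rw [map_neg, neg_le_iff_add_nonneg']; exact h₂
    have := (algebraMap_le_iff_le_spectrum (R := ℝ) ha).1 h₃ _ h
    linarith

end Order

namespace OrderUnitSubspace

variable {A : Type*} [CStarAlgebra A] [PartialOrder A] {D : OrderUnitSubspace A}

theorem State.map_smul_unit (μ : D.State) (t : ℝ) : μ.1 (t • D.unit) = t := by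
  rw [map_smul, μ.2.2, smul_eq_mul, mul_one]

theorem edist_rho_le_iff {L : Seminorm ℝ D} {μ ν : D.State} {r : ℝ} (hr : 0 ≤ r) :
    (D.rho L).edist μ ν ≤ ENNReal.ofReal r ↔ ∀ a : D, L a ≤ 1 → |μ.1 a - ν.1 a| ≤ r := by
  change (⨆ (a : D) (_ : L a ≤ 1), edist (μ.1 a) (ν.1 a)) ≤ _ ↔ _
  simp only [iSup_le_iff, edist_dist, ENNReal.ofReal_le_ofReal_iff hr, Real.dist_eq]

/-- The state `(1 - t) μ + t ν`. -/
def State.lineMap (μ ν : D.State) (t : ℝ) (h₀ : 0 ≤ t) (h₁ : t ≤ 1) : D.State :=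
  ⟨(1 - t) • μ.1 + t • ν.1, fun a ha => add_nonneg
    (mul_nonneg (sub_nonneg.2 h₁) (μ.2.1 a ha)) (mul_nonneg h₀ (ν.2.1 a ha)), by
      simp [μ.2.2, ν.2.2]⟩

/-- `ρ_L` is finite: the states `(1 - t) μ + t ν` tend to `μ` as `t → 0`, and their distance to `μ`
is `t ρ_L(μ, ν)`. -/
theorem IsLipNorm.exists_abs_sub_le {L : Seminorm ℝ D} (hL : D.IsLipNorm L) (μ ν : D.State) :
    ∃ C : ℝ, ∀ a : D, L a ≤ 1 → |ν.1 a - μ.1 a| ≤ C := by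
  let σ : ℕ → D.State := fun n => State.lineMap μ ν (1 / ((n : ℝ) + 1)) (by positivity)
    (by rw [div_le_one (by positivity)]; simp)
  have hσ : ∀ n a, (σ n).1 a - μ.1 a = (1 / ((n : ℝ) + 1)) * (ν.1 a - μ.1 a) := fun n a => by
    simp only [σ, State.lineMap, LinearMap.add_apply, LinearMap.smul_apply, smul_eq_mul]
    ring
  have h₁ : Filter.Tendsto σ Filter.atTop (@nhds _ D.weakStar μ) := by
    let := D.weakStar
    have hind : Topology.IsInducing (fun (μ : D.State) (a : D) => μ.1 a) := ⟨rfl⟩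
    rw [hind.tendsto_nhds_iff, tendsto_pi_nhds]
    intro a
    have := (tendsto_one_div_add_atTop_nhds_zero_nat (𝕜 := ℝ)).mul_const (ν.1 a - μ.1 a)
    have := this.add_const (μ.1 a)
    rw [zero_mul, zero_add] at this
    refine this.congr fun n => ?_
    simp only [Function.comp, ← hσ]
    ring
  rw [← hL.topology_eq] at h₁
  let := D.rho L
  obtain ⟨n, hn⟩ := (h₁.eventually (Metric.eball_mem_nhds μ one_pos)).exists
  have hn' : (D.rho L).edist (σ n) μ ≤ ENNReal.ofReal 1 := by
    rw [ENNReal.ofReal_one]; exact hn.le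
  refine ⟨n + 1, fun a ha => ?_⟩
  have h₂ := (edist_rho_le_iff zero_le_one).1 hn' a ha
  have hpos : (0 : ℝ) < (n : ℝ) + 1 := by positivity
  rwa [hσ, abs_mul, abs_of_pos (by positivity), one_div, inv_mul_le_iff₀ hpos, mul_one] at h₂

variable [StarOrderedRing A]

theorem State.abs_apply_le (μ : D.State) (a : D) : |μ.1 a| ≤ ‖(a : A)‖ := by
  have ha := D.isSelfAdjoint' a a.2
  have h₁ := μ.2.1 (‖(a : A)‖ • D.unit - a) (smul_one_sub_nonneg ha le_rfl)
  have h₂ := μ.2.1 (‖(a : A)‖ • D.unit - (-a)) (smul_one_sub_nonneg ha.neg (norm_neg _).le)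
  rw [map_sub, State.map_smul_unit] at h₁ h₂
  rw [map_neg] at h₂
  exact abs_le.2 ⟨by linarith, by linarith⟩

/-- If `‖a‖` lies in the spectrum of `a`, then `‖1 + a‖ = 1 + ‖a‖`, so a norm-one functional
attaining its norm at `1 + a` is `1` at the unit and `‖a‖` at `a`. Being unital and contractive, it is
positive. -/
theorem exists_state_apply_eq_of_norm_mem_spectrum [Nontrivial A] (a : D)
    (ha : ‖(a : A)‖ ∈ spectrum ℝ (a : A)) : ∃ μ : D.State, μ.1 a = ‖(a : A)‖ := by
  obtain ⟨f, hf, hfv⟩ := exists_dual_vector'' ℝ ((1 : A) + (a : A))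
  have hle : ∀ x : A, f x ≤ ‖x‖ := fun x =>
    (le_abs_self _).trans ((f.le_opNorm x).trans (mul_le_of_le_one_left (norm_nonneg _) hf))
  have hnorm : 1 + ‖(a : A)‖ ≤ ‖(1 : A) + (a : A)‖ := by
    have h : 1 + ‖(a : A)‖ ∈ spectrum ℝ ((1 : A) + (a : A)) := by
      rw [add_comm 1 ‖(a : A)‖]
      simpa using spectrum.add_mem_add_iff (r := ‖(a : A)‖) (s := (1 : ℝ)) (a := (a : A)) |>.2 ha
    have := spectrum.norm_le_norm_of_mem h
    rwa [Real.norm_of_nonneg (by positivity)] at this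
  have h₁ : f 1 ≤ 1 := by simpa using hle 1
  have h₂ := hle a
  have h₃ : f 1 + f a = ‖(1 : A) + (a : A)‖ := by simpa using hfv
  have hf1 : f 1 = 1 := by linarith
  refine ⟨⟨f.toLinearMap ∘ₗ D.toSubmodule.subtype, fun b hb => ?_, hf1⟩, ?_⟩
  · have h₄ : ‖‖(b : A)‖ • (1 : A) - b‖ ≤ ‖(b : A)‖ := by
      have hb' := D.isSelfAdjoint' b b.2
      refine norm_le_of_smul_one_sub_nonneg ?_ (norm_nonneg _) ?_ ?_
      · exact (IsSelfAdjoint.smul (IsSelfAdjoint.all _) (IsSelfAdjoint.one A)).sub hb'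
      · simpa using hb
      · have := smul_one_sub_nonneg hb' le_rfl
        exact add_nonneg (smul_nonneg (norm_nonneg _) zero_le_one) this
    have h₅ := (hle _).trans h₄
    rw [map_sub, map_smul, hf1, smul_eq_mul, mul_one] at h₅
    change 0 ≤ f b
    linarith
  · change f a = _
    linarith

/-- The norm of an element of an order-unit space is attained by a state, since `‖a‖` or `-‖a‖`
lies in the spectrum of `a`. -/
theorem exists_state_abs_apply_eq [Nontrivial A] (a : D) : ∃ μ : D.State, |μ.1 a| = ‖(a : A)‖ := by
  rcases CStarAlgebra.norm_or_neg_norm_mem_spectrum (D.isSelfAdjoint' a a.2) with h | h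
  · obtain ⟨μ, hμ⟩ := exists_state_apply_eq_of_norm_mem_spectrum a h
    exact ⟨μ, by rw [hμ, abs_norm]⟩
  · obtain ⟨μ, hμ⟩ := exists_state_apply_eq_of_norm_mem_spectrum (-a) (by
      have : ‖(a : A)‖ ∈ spectrum ℝ (-(a : A)) := by
        rw [← spectrum.neg_eq]; simpa using h
      simpa using this)
    refine ⟨μ, ?_⟩
    rw [map_neg] at hμ
    rw [← abs_neg, hμ, abs_norm]
    simp

theorem norm_le_of_forall_state [Nontrivial A] (a : D) {r : ℝ}
    (h : ∀ μ : D.State, |μ.1 a| ≤ r) : ‖(a : A)‖ ≤ r := by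
  obtain ⟨μ, hμ⟩ := exists_state_abs_apply_eq a
  exact hμ ▸ h μ

/-- The state space is weak⋆ compact: it is closed in the product of the intervals `[-‖a‖, ‖a‖]`. -/
theorem isCompact_univ_state : @IsCompact D.State D.weakStar Set.univ := by
  let := D.weakStar
  have hind : Topology.IsInducing (fun (μ : D.State) (a : D) => μ.1 a) := ⟨rfl⟩
  rw [hind.isCompact_iff, Set.image_univ]
  refine (isCompact_univ_pi fun a : D => isCompact_Icc (a := -‖(a : A)‖)
    (b := ‖(a : A)‖)).of_isClosed_subset ?_ ?_
  · have : Set.range (fun (μ : D.State) (a : D) => μ.1 a) =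
        Set.range ((↑) : (D →ₗ[ℝ] ℝ) → D → ℝ) ∩
          ({f | ∀ a : D, 0 ≤ (a : A) → 0 ≤ f a} ∩ {f | f D.unit = 1}) := by
      ext f
      constructor
      · rintro ⟨μ, rfl⟩
        exact ⟨⟨μ.1, rfl⟩, μ.2⟩
      · rintro ⟨⟨g, rfl⟩, hg⟩
        exact ⟨⟨g, hg⟩, rfl⟩
    rw [this]
    refine (LinearMap.isClosed_range_coe _ _ _).inter (IsClosed.inter ?_ ?_)
    · simp only [Set.ofPred_forall]
      exact isClosed_iInter fun a => isClosed_iInter fun _ =>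
        isClosed_le continuous_const (continuous_apply a)
    · exact isClosed_eq (continuous_apply _) continuous_const
  · rintro _ ⟨μ, rfl⟩ a -
    exact abs_le.1 (μ.abs_apply_le a)

/-- Lipschitz balls of a Lip-norm are totally bounded modulo scalars. The elements of the unit ball
vanishing at a given state are equi-Lipschitz functions on the compact state space, and the norm is
the supremum norm over the states. -/
theorem IsLipNorm.exists_totallyBounded [Nontrivial A] {L : Seminorm ℝ D} (hL : D.IsLipNorm L) :
    ∃ K : Set A, TotallyBounded K ∧ ∀ a : D, L a ≤ 1 → ∃ t : ℝ, (a : A) - t • (1 : A) ∈ K := by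
  obtain ⟨μ₀, -⟩ := exists_state_abs_apply_eq (0 : D)
  let S : Set D := {a | L a ≤ 1 ∧ μ₀.1 a = 0}
  have hS : TotallyBounded S := by
    rw [Metric.totallyBounded_iff]
    intro ε hε
    obtain ⟨T, hTf, hT⟩ : ∃ T : Set D.State, T.Finite ∧ ∀ σ : D.State, ∃ ν ∈ T,
        ∀ a : D, L a ≤ 1 → |σ.1 a - ν.1 a| ≤ ε / 4 := by
      have hc := isCompact_univ_state (D := D)
      rw [← hL.topology_eq] at hc
      let := D.rho L
      obtain ⟨T, hTf, hT⟩ := EMetric.totallyBounded_iff.1 hc.totallyBounded (ENNReal.ofReal (ε / 4))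
        (by simpa using hε)
      refine ⟨T, hTf, fun σ => ?_⟩
      obtain ⟨ν, hν, hσ⟩ := Set.mem_iUnion₂.1 (hT (Set.mem_univ σ))
      exact ⟨ν, hν, (edist_rho_le_iff (by positivity)).1 (le_of_lt hσ)⟩
    have := hTf.fintype
    let e : D → T → ℝ := fun a ν => ν.1.1 a
    -- `S` is embedded in `ℝ ^ T` up to `ε`; its image is bounded since `ρ_L` is finite.
    have hb : TotallyBounded (e '' S) := by
      choose C hC using fun ν : T => hL.exists_abs_sub_le μ₀ ν.1
      refine (isCompact_univ_pi fun ν : T => isCompact_Icc (a := -C ν)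
        (b := C ν)).totallyBounded.subset ?_
      rintro _ ⟨a, ha, rfl⟩ ν -
      have := hC ν a ha.1
      rw [ha.2, sub_zero] at this
      exact abs_le.1 this
    obtain ⟨F, hFS, hFf, hF⟩ := Metric.finite_approx_of_totallyBounded hb (ε / 4) (by positivity)
    obtain ⟨G, hGS, hGf, rfl⟩ := Set.exists_subset_image_finite_and.1 ⟨F, hFS, hFf, rfl⟩
    refine ⟨G, hGf, fun a ha => ?_⟩
    obtain ⟨_, ⟨b, hb, rfl⟩, hab⟩ := Set.mem_iUnion₂.1 (hF (Set.mem_image_of_mem e ha))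
    refine Set.mem_iUnion₂.2 ⟨b, hb, ?_⟩
    rw [Metric.mem_ball, dist_eq_norm]
    refine lt_of_le_of_lt (b := 3 * (ε / 4)) ?_ (by linarith)
    refine norm_le_of_forall_state (a - b) fun σ => ?_
    obtain ⟨ν, hν, hσ⟩ := hT σ
    have h₁ := abs_le.1 (hσ a ha.1)
    have h₂ := abs_le.1 (hσ b (hGS hb).1)
    have h₃ := ((dist_le_pi_dist (e a) (e b) ⟨ν, hν⟩).trans_lt hab).le
    rw [Real.dist_eq] at h₃
    have h₄ := abs_le.1 h₃
    simp only [e] at h₄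
    rw [map_sub]
    exact abs_le.2 ⟨by linarith, by linarith⟩
  refine ⟨(↑) '' S, hS.image uniformContinuous_subtype_val, fun a ha => ⟨μ₀.1 a, ?_⟩⟩
  have hu : L D.unit = 0 := (hL.eq_zero_iff _).2 ⟨1, (one_smul _ _).symm⟩
  refine ⟨a - μ₀.1 a • D.unit, ⟨?_, ?_⟩, rfl⟩
  · refine (map_sub_le_add L _ _).trans ?_
    rw [map_smul_eq_mul, hu, mul_zero, add_zero]
    exact ha
  · rw [map_sub, State.map_smul_unit, sub_self]

/-- A seminorm vanishing exactly on the scalars is a Lip-norm if its unit ball is totally bounded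
modulo scalars. -/
theorem isLipNorm_of_totallyBounded {L : Seminorm ℝ D}
    (hL : ∀ a : D, L a = 0 ↔ ∃ t : ℝ, a = t • D.unit) {K : Set A} (hK : TotallyBounded K)
    (hLK : ∀ a : D, L a ≤ 1 → ∃ t : ℝ, (a : A) - t • (1 : A) ∈ K) : D.IsLipNorm L := by
  refine ⟨hL, le_antisymm ?_ ?_⟩
  · let := D.rho L
    refine continuous_iff_le_induced.1 (continuous_pi fun a => ?_)
    have hpos : 0 < L a + 1 := by have := apply_nonneg L a; linarith
    refine LipschitzWith.continuous (K := (L a + 1).toNNReal) fun μ ν => ?_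
    have hb : L ((L a + 1)⁻¹ • a) ≤ 1 := by
      rw [map_smul_eq_mul, Real.norm_of_nonneg (by positivity), inv_mul_le_iff₀ hpos]
      linarith
    have h := le_iSup₂ (f := fun (a : D) (_ : L a ≤ 1) => edist (μ.1 a) (ν.1 a)) _ hb
    have ha : ∀ σ : D.State, σ.1 a = (L a + 1) • σ.1 ((L a + 1)⁻¹ • a) := fun σ => by
      rw [← map_smul, smul_inv_smul₀ hpos.ne']
    change edist (μ.1 a) (ν.1 a) ≤ _
    rw [ha μ, ha ν, edist_smul₀]
    refine le_trans (le_of_eq ?_) (mul_le_mul_right h _)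
    rw [ENNReal.smul_def, smul_eq_mul, ← Real.toNNReal_eq_nnnorm_of_nonneg hpos.le]
  · have hind : @Topology.IsInducing _ _ D.weakStar _ (fun (μ : D.State) (a : D) => μ.1 a) :=
      @Topology.IsInducing.mk _ _ D.weakStar _ _ rfl
    let t := D.weakStar
    refine le_of_nhds_le_nhds fun μ => ?_
    let := D.rho L
    refine (Metric.nhds_basis_eball (x := μ)).ge_iff.2 fun η hη => ?_
    obtain ⟨r, hr, hrη⟩ := ENNReal.lt_iff_exists_real_btwn.1 hη
    have hr0 : 0 < r := by
      by_contra h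
      simp [ENNReal.ofReal_of_nonpos (not_lt.1 h)] at hrη
    obtain ⟨F, hFS, hFf, hF⟩ := Metric.finite_approx_of_totallyBounded
      (totallyBounded_preimage (f := ((↑) : D → A)) (isUniformInducing_val _) hK) (r / 3)
      (by positivity)
    have hmem : ∀ᶠ ν in @nhds _ t μ, ∀ b ∈ F, |ν.1 b - μ.1 b| < r / 3 := by
      rw [Filter.eventually_all_finite hFf]
      intro b _
      have h₁ := ((continuous_apply b).comp hind.continuous).tendsto μ
      simpa [Real.dist_eq] using h₁.eventually (Metric.ball_mem_nhds _ (by positivity))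
    filter_upwards [hmem] with ν hν
    refine lt_of_le_of_lt ?_ hrη.2
    refine (edist_rho_le_iff hr0.le).2 fun a ha => ?_
    obtain ⟨s, hs⟩ := hLK a ha
    obtain ⟨b, hb, hab⟩ := Set.mem_iUnion₂.1
      (hF (show a - s • D.unit ∈ ((↑) : D → A) ⁻¹' K from hs))
    rw [Metric.mem_ball, dist_eq_norm] at hab
    have h₁ := abs_le.1 ((ν.abs_apply_le (a - s • D.unit - b)).trans hab.le)
    have h₂ := abs_le.1 ((μ.abs_apply_le (a - s • D.unit - b)).trans hab.le)
    have h₃ := abs_lt.1 (hν b hb)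
    rw [map_sub, map_sub, State.map_smul_unit] at h₁ h₂
    exact abs_le.2 ⟨by linarith, by linarith⟩

end OrderUnitSubspace

/-! ### Elementary properties of u.c.p. maps -/

section SelfAdjoint

variable {A : Type*} [CStarAlgebra A] {X : OperatorSystem A}

theorem OperatorSystem.realPart_mem (X : OperatorSystem A) {x : A} (hx : x ∈ X.toSubmodule) :
    (realPart x : A) ∈ X.toSubmodule := by
  rw [realPart_apply_coe, ← Complex.coe_smul]
  exact X.smul_mem _ (X.add_mem hx (X.star_mem' _ hx))

theorem OperatorSystem.imaginaryPart_mem (X : OperatorSystem A) {x : A} (hx : x ∈ X.toSubmodule) :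
    (imaginaryPart x : A) ∈ X.toSubmodule := by
  rw [imaginaryPart_apply_coe, ← Complex.coe_smul]
  exact X.smul_mem _ (X.smul_mem _ (X.sub_mem hx (X.star_mem' _ hx)))

theorem OperatorSystem.exists_isSelfAdjoint_add_I_smul (x : X) : ∃ a b : X,
    IsSelfAdjoint (a : A) ∧ IsSelfAdjoint (b : A) ∧ ‖a‖ ≤ ‖x‖ ∧ ‖b‖ ≤ ‖x‖ ∧
      x = a + Complex.I • b :=
  ⟨⟨_, X.realPart_mem x.2⟩, ⟨_, X.imaginaryPart_mem x.2⟩, (realPart (x : A)).2,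
    (imaginaryPart (x : A)).2, realPart.norm_le _, imaginaryPart.norm_le _,
    Subtype.ext (realPart_add_I_smul_imaginaryPart (x : A)).symm⟩

end SelfAdjoint

section Maps

variable {A B : Type*}
  [CStarAlgebra A] [PartialOrder A] [StarOrderedRing A]
  [CStarAlgebra B] [PartialOrder B] [StarOrderedRing B]
  {X : OperatorSystem A} {Y : OperatorSystem B} {φ : X →ₗ[ℂ] Y}

theorem starAlgEquiv_apply_nonneg (e : A ≃⋆ₐ[ℂ] B) {a : A} (ha : 0 ≤ a) : 0 ≤ e a := by
  obtain ⟨b, rfl⟩ := CStarAlgebra.nonneg_iff_eq_star_mul_self.1 ha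
  rw [map_mul, map_star]
  exact star_mul_self_nonneg _

theorem IsUCP.nonneg_apply (hφ : IsUCP φ) {x : X} (hx : 0 ≤ (x : A)) : 0 ≤ ((φ x : Y) : B) := by
  have h := hφ.map_nonneg 1 (CStarMatrix.ofMatrix fun _ _ => x)
    (starAlgEquiv_apply_nonneg (CStarMatrix.toOneByOne (Fin 1) ℂ A) hx)
  exact starAlgEquiv_apply_nonneg (CStarMatrix.toOneByOne (Fin 1) ℂ B).symm h

theorem IsUCP.coe_map_smul_unit (hφ : IsUCP φ) (r : ℝ) : ((φ (r • X.unit) : Y) : B) = r • 1 := by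
  have : φ (r • X.unit) = r • Y.unit := by
    rw [← Complex.coe_smul, ← Complex.coe_smul, map_smul, hφ.map_unit]
  rw [this]; rfl

theorem IsUCP.isSelfAdjoint_apply (hφ : IsUCP φ) {x : X} (hx : IsSelfAdjoint (x : A)) :
    IsSelfAdjoint ((φ x : Y) : B) := by
  have h := hφ.nonneg_apply (x := ‖(x : A)‖ • X.unit - x) (smul_one_sub_nonneg hx le_rfl)
  have h₁ : ((φ (‖(x : A)‖ • X.unit - x) : Y) : B) = ‖(x : A)‖ • 1 - φ x := by
    rw [map_sub, ← hφ.coe_map_smul_unit]; rfl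
  rw [h₁] at h
  have h₂ := (IsSelfAdjoint.smul (IsSelfAdjoint.all ‖(x : A)‖) (IsSelfAdjoint.one B)).sub
    (IsSelfAdjoint.of_nonneg h)
  rwa [sub_sub_cancel] at h₂

/-- U.c.p. maps are contractive on self-adjoint elements, as they preserve the order interval
`[-‖x‖ 1, ‖x‖ 1]`. -/
theorem IsUCP.norm_apply_le (hφ : IsUCP φ) {x : X} (hx : IsSelfAdjoint (x : A)) :
    ‖((φ x : Y) : B)‖ ≤ ‖(x : A)‖ := by
  refine norm_le_of_smul_one_sub_nonneg (hφ.isSelfAdjoint_apply hx) (norm_nonneg _) ?_ ?_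
  · have h := hφ.nonneg_apply (x := ‖(x : A)‖ • X.unit - x) (smul_one_sub_nonneg hx le_rfl)
    rwa [map_sub, Submodule.coe_sub, hφ.coe_map_smul_unit] at h
  · have h := hφ.nonneg_apply (x := ‖(x : A)‖ • X.unit + x) (by
      have := smul_one_sub_nonneg hx.neg (norm_neg _).le
      rwa [sub_neg_eq_add] at this)
    rwa [map_add, Submodule.coe_add, hφ.coe_map_smul_unit] at h

theorem IsUCP.apply_star (hφ : IsUCP φ) (x : X) :
    ((φ ⟨star x, X.star_mem' _ x.2⟩ : Y) : B) = star ((φ x : Y) : B) := by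
  obtain ⟨a, b, ha, hb, -, -, hx⟩ := OperatorSystem.exists_isSelfAdjoint_add_I_smul x
  have h : (⟨star x, X.star_mem' _ x.2⟩ : X) = a - Complex.I • b := by
    apply Subtype.ext
    simp [hx, ha.star_eq, hb.star_eq, sub_eq_add_neg]
  rw [h, hx, map_sub, map_add, map_smul]
  simp [(hφ.isSelfAdjoint_apply ha).star_eq, (hφ.isSelfAdjoint_apply hb).star_eq, sub_eq_add_neg]

/-- A u.c.p. map, as a continuous linear map into the ambient C⋆-algebra of its codomain. The bound
`2`, from the decomposition into self-adjoint parts, is enough for continuity. -/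
def IsUCP.toCLM (hφ : IsUCP φ) : X →L[ℂ] B :=
  (Y.toSubmodule.subtype ∘ₗ φ).mkContinuous 2 fun x => by
    obtain ⟨a, b, ha, hb, hax, hbx, hx⟩ := OperatorSystem.exists_isSelfAdjoint_add_I_smul x
    have h : (Y.toSubmodule.subtype ∘ₗ φ) x = (φ a : B) + Complex.I • (φ b : B) := by
      conv_lhs => rw [hx]
      simp
    rw [h, two_mul]
    refine (norm_add_le _ _).trans (add_le_add ((hφ.norm_apply_le ha).trans hax) ?_)
    rw [norm_smul, Complex.norm_I, one_mul]
    exact (hφ.norm_apply_le hb).trans hbx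

theorem IsUCP.toCLM_unit (hφ : IsUCP φ) : hφ.toCLM X.unit = 1 := congrArg Subtype.val hφ.map_unit

end Maps

/-! ### The Lip-norm on the image of a u.c.p. map into a matrix algebra -/

section QuotientSeminorm

variable {E F : Type*} [AddCommGroup E] [Module ℝ E] [AddCommGroup F] [Module ℝ F]

theorem bddBelow_seminorm_fiber (f : E →ₗ[ℝ] F) (p : Seminorm ℝ E) (y : F) :
    BddBelow (Set.range fun x : {x // f x = y} => p x) :=
  ⟨0, by rintro _ ⟨x, rfl⟩; exact apply_nonneg p _⟩

/-- The quotient seminorm `y ↦ inf {p x : f x = y}` of `p` along a linear map `f`, on the range of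
`f`. -/
def quotientSeminorm (f : E →ₗ[ℝ] F) (p : Seminorm ℝ E) : Seminorm ℝ (LinearMap.range f) :=
  Seminorm.ofSMulLE (fun y => ⨅ x : {x // f x = y}, p x)
    (le_antisymm ((ciInf_le (bddBelow_seminorm_fiber f p _) ⟨0, map_zero f⟩).trans
      (map_zero p).le) (Real.iInf_nonneg fun _ => apply_nonneg p _))
    (fun y z => by
      obtain ⟨y, y', hy⟩ := y
      obtain ⟨z, z', hz⟩ := z
      have : Nonempty {x // f x = y} := ⟨y', hy⟩
      have : Nonempty {x // f x = z} := ⟨z', hz⟩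
      refine le_ciInf_add_ciInf fun a b => ?_
      refine (ciInf_le (bddBelow_seminorm_fiber f p _) ⟨a.1 + b.1, ?_⟩).trans
        (map_add_le_add p _ _)
      rw [map_add, a.2, b.2]; rfl)
    (fun r y => by
      obtain ⟨y, y', hy⟩ := y
      have : Nonempty {x // f x = y} := ⟨y', hy⟩
      rw [Real.mul_iInf_of_nonneg (norm_nonneg r)]
      refine le_ciInf fun a => ?_
      refine (ciInf_le (bddBelow_seminorm_fiber f p _) ⟨r • a.1, ?_⟩).trans
        (map_smul_eq_mul p _ _).le
      rw [map_smul, a.2]; rfl)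

theorem quotientSeminorm_apply_le (f : E →ₗ[ℝ] F) (p : Seminorm ℝ E) {y : LinearMap.range f} {x : E}
    (h : f x = y) : quotientSeminorm f p y ≤ p x :=
  ciInf_le (bddBelow_seminorm_fiber f p _) (⟨x, h⟩ : {x // f x = y})

theorem exists_lt_of_quotientSeminorm_lt (f : E →ₗ[ℝ] F) (p : Seminorm ℝ E)
    {y : LinearMap.range f} {r : ℝ} (h : quotientSeminorm f p y < r) : ∃ x, f x = y ∧ p x < r := by
  obtain ⟨x, hx⟩ := y.2
  have : Nonempty {x // f x = y} := ⟨x, hx⟩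
  obtain ⟨z, hz⟩ := exists_lt_of_ciInf_lt (show (⨅ x : {x // f x = y}, p x) < r from h)
  exact ⟨z.1, z.2, hz⟩

end QuotientSeminorm

instance (k : ℕ) : FiniteDimensional ℂ (Mat k) :=
  (CStarMatrix.ofMatrixₗ (m := Fin k) (n := Fin k) (R := ℂ) (A := ℂ)).finiteDimensional

instance (k : ℕ) : FiniteDimensional ℝ (Mat k) := FiniteDimensional.complexToReal _

theorem OrderUnitSubspace.IsLipNorm.exists_norm_sub_smul_le {A : Type*} [CStarAlgebra A]
    [PartialOrder A] [StarOrderedRing A] [Nontrivial A] {D : OrderUnitSubspace A}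
    {L : Seminorm ℝ D} (hL : D.IsLipNorm L) :
    ∃ C : ℝ, ∀ r : ℝ, 0 < r → ∀ a : D, L a ≤ r → ∃ t : ℝ, ‖(a : A) - t • (1 : A)‖ ≤ r * C := by
  obtain ⟨K, hK, hLK⟩ := hL.exists_totallyBounded
  obtain ⟨C, hC⟩ := hK.isBounded.exists_norm_le
  refine ⟨C, fun r hr a ha => ?_⟩
  obtain ⟨t, ht⟩ := hLK (r⁻¹ • a) (by
    rwa [map_smul_eq_mul, Real.norm_of_nonneg (by positivity), inv_mul_le_iff₀ hr, mul_one])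
  refine ⟨r * t, ?_⟩
  have h : (a : A) - (r * t) • (1 : A) = r • (((r⁻¹ • a : D) : A) - t • (1 : A)) := by
    rw [smul_sub, Submodule.coe_smul, smul_inv_smul₀ hr.ne', mul_smul]
  rw [h, norm_smul, Real.norm_of_nonneg hr.le]
  exact mul_le_mul_of_nonneg_left (hC _ ht) hr.le

theorem isClosed_seminorm_unitBall {V : Type*} [NormedAddCommGroup V] [NormedSpace ℝ V]
    [FiniteDimensional ℝ V] (S : Submodule ℝ V) (p : Seminorm ℝ S) :
    IsClosed {a : V | ∃ d : S, (d : V) = a ∧ p d ≤ 1} := by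
  have hp : Continuous p := continuousOn_univ.1 (p.convexOn.continuousOn isOpen_univ)
  have h := S.closed_of_finiteDimensional.isClosedEmbedding_subtypeVal.isClosedMap {d | p d ≤ 1}
    (isClosed_le hp continuous_const)
  convert h using 1
  ext a
  exact ⟨fun ⟨d, hd, h⟩ => ⟨d, h, hd⟩, fun ⟨d, h, hd⟩ => ⟨d, hd, h⟩⟩

section Range

variable {A : Type*} [CStarAlgebra A] [PartialOrder A] [StarOrderedRing A] {X : OperatorSystem A}
  {k : ℕ} {φ : X →ₗ[ℂ] OperatorSystem.full (Mat k)}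

/-- The image of an operator system under a u.c.p. map into `M_k`, an operator subsystem of `M_k`
(closed since it is finite-dimensional). -/
def IsUCP.range (hφ : IsUCP φ) : OperatorSystem (Mat k) where
  toSubmodule := LinearMap.range hφ.toCLM.toLinearMap
  one_mem' := ⟨X.unit, hφ.toCLM_unit⟩
  star_mem' := by
    rintro _ ⟨x, rfl⟩
    exact ⟨⟨star x, X.star_mem' _ x.2⟩, hφ.apply_star x⟩
  isClosed' := (LinearMap.range hφ.toCLM.toLinearMap).closed_of_finiteDimensional

/-- The corestriction of a u.c.p. map into `M_k` to its range. -/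
def IsUCP.rangeRestrict (hφ : IsUCP φ) : X →ₗ[ℂ] hφ.range :=
  hφ.toCLM.toLinearMap.rangeRestrict

theorem IsUCP.isUCP_rangeRestrict (hφ : IsUCP φ) : IsUCP hφ.rangeRestrict where
  map_unit := Subtype.ext hφ.toCLM_unit
  map_nonneg := hφ.map_nonneg

/-- The restriction to an operator subsystem of `M_k` of a linear map on `M_k`. -/
def restrictMat {A : Type*} [CStarAlgebra A] {X : OperatorSystem A} {k : ℕ}
    (γ : OperatorSystem.full (Mat k) →ₗ[ℂ] X) (Y : OperatorSystem (Mat k)) : Y →ₗ[ℂ] X :=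
  γ ∘ₗ Submodule.inclusion (fun _ _ => trivial)

theorem IsUCP.restrictMat {γ : OperatorSystem.full (Mat k) →ₗ[ℂ] X} (hγ : IsUCP γ)
    (Y : OperatorSystem (Mat k)) : IsUCP (restrictMat γ Y) where
  map_unit := hγ.map_unit
  map_nonneg m M hM := hγ.map_nonneg m
    (M.map (Submodule.inclusion (p' := (OperatorSystem.full (Mat k)).toSubmodule)
      (fun _ _ => trivial))) hM

/-- The inclusion of the domain of a Lip-norm into the operator system, as a linear map. -/
def LipNorm.inclₗ (LX : LipNorm X) : LX.domain →ₗ[ℝ] X where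
  toFun := LX.incl
  map_add' _ _ := rfl
  map_smul' _ _ := rfl

/-- The restriction of a u.c.p. map to the domain of a Lip-norm. -/
def IsUCP.onDomain {B : Type*} [CStarAlgebra B] [PartialOrder B] [StarOrderedRing B]
    {Y : OperatorSystem B} {φ : X →ₗ[ℂ] Y} (hφ : IsUCP φ) (LX : LipNorm X) : LX.domain →ₗ[ℝ] B :=
  hφ.toCLM.toLinearMap.restrictScalars ℝ ∘ₗ LX.inclₗ

theorem IsUCP.norm_onDomain_sub_smul_le {B : Type*} [CStarAlgebra B] [PartialOrder B]
    [StarOrderedRing B] {Y : OperatorSystem B} {φ : X →ₗ[ℂ] Y} (hφ : IsUCP φ) (LX : LipNorm X)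
    (a : LX.domain) (t : ℝ) : ‖hφ.onDomain LX a - t • (1 : B)‖ ≤ ‖(a : A) - t • (1 : A)‖ := by
  have h : hφ.onDomain LX a - t • (1 : B) = φ (LX.incl a - t • X.unit) := by
    rw [map_sub, Submodule.coe_sub, hφ.coe_map_smul_unit]; rfl
  rw [h]
  exact hφ.norm_apply_le ((LX.domain.isSelfAdjoint' a a.2).sub
    (IsSelfAdjoint.smul (IsSelfAdjoint.all t) (IsSelfAdjoint.one A)))

/-- The image of the domain of a Lip-norm under a u.c.p. map into `M_k`. -/
def IsUCP.rangeDomain (hφ : IsUCP φ) (LX : LipNorm X) : OrderUnitSubspace (Mat k) where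
  toSubmodule := LinearMap.range (hφ.onDomain LX)
  one_mem' := ⟨LX.domain.unit, hφ.toCLM_unit⟩
  isSelfAdjoint' := by
    rintro _ ⟨a, rfl⟩
    exact hφ.isSelfAdjoint_apply (LX.domain.isSelfAdjoint' a a.2)

/-- The image of the domain is dense in the self-adjoint part of the range: a self-adjoint `φ(x)` is
also the image of the real part of `x`. -/
theorem IsUCP.mem_closure_rangeDomain (hφ : IsUCP φ) (LX : LipNorm X) (x : X)
    (hx : IsSelfAdjoint (hφ.toCLM x)) :
    hφ.toCLM x ∈ closure ((hφ.rangeDomain LX).carrier : Set (Mat k)) := by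
  let a : X := ⟨_, X.realPart_mem x.2⟩
  have hxa : hφ.toCLM x = hφ.toCLM a := by
    have h : (2 : ℂ) • a = x + ⟨star (x : A), X.star_mem' _ x.2⟩ := by
      apply Subtype.ext
      change (2 : ℂ) • (realPart (x : A) : A) = x + star (x : A)
      rw [realPart_apply_coe, ← Complex.coe_smul, smul_smul]
      norm_num
    have h₁ := congrArg hφ.toCLM h
    have h₂ : hφ.toCLM ⟨star (x : A), X.star_mem' _ x.2⟩ = hφ.toCLM x :=
      (hφ.apply_star x).trans hx.star_eq
    rw [map_smul, map_add, h₂, ← two_smul ℂ] at h₁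
    exact (smul_right_injective _ two_ne_zero h₁).symm
  rw [hxa]
  have ha : a ∈ closure ((↑) ⁻¹' (LX.domain.carrier : Set A) : Set X) := by
    rw [Topology.IsInducing.subtypeVal.closure_eq_preimage_closure_image]
    refine closure_mono ?_ (LX.dense _ a.2 (realPart (x : A)).2)
    exact fun b hb => ⟨⟨b, LX.domain_le b hb⟩, hb, rfl⟩
  refine map_mem_closure hφ.toCLM.continuous ha fun b hb => ?_
  exact ⟨⟨b, hb⟩, rfl⟩

variable [Nontrivial A]

theorem IsUCP.exists_norm_sub_smul_le_of_quotientSeminorm_lt (hφ : IsUCP φ) (LX : LipNorm X) :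
    ∃ C : ℝ, ∀ r : ℝ, 0 < r → ∀ y : LinearMap.range (hφ.onDomain LX),
      quotientSeminorm (hφ.onDomain LX) LX.L y < r → ∃ t : ℝ, ‖(y : Mat k) - t • 1‖ ≤ r * C := by
  obtain ⟨C, hC⟩ := LX.isLipNorm.exists_norm_sub_smul_le
  refine ⟨C, fun r hr y hy => ?_⟩
  obtain ⟨x, hxy, hx⟩ := exists_lt_of_quotientSeminorm_lt _ _ hy
  obtain ⟨t, ht⟩ := hC r hr x hx.le
  exact ⟨t, by rw [← hxy]; exact (hφ.norm_onDomain_sub_smul_le LX x t).trans ht⟩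

theorem IsUCP.isLipNorm_quotientSeminorm (hφ : IsUCP φ) (LX : LipNorm X) :
    (hφ.rangeDomain LX).IsLipNorm (quotientSeminorm (hφ.onDomain LX) LX.L) := by
  obtain ⟨C, hC⟩ := hφ.exists_norm_sub_smul_le_of_quotientSeminorm_lt LX
  refine OrderUnitSubspace.isLipNorm_of_totallyBounded (K := Metric.closedBall 0 (2 * C))
    (fun y => ⟨fun hy => ?_, ?_⟩) (isCompact_closedBall _ _).totallyBounded fun y hy => ?_
  · -- `y` is within `δ` of the scalars for every `δ > 0`, and the scalars form a closed subspace.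
    have hmem : (y : Mat k) ∈ closure ((Submodule.span ℝ {(1 : Mat k)} : Set (Mat k))) := by
      refine Metric.mem_closure_iff.2 fun δ hδ => ?_
      have hpos : 0 < δ / (|C| + 1) := by positivity
      obtain ⟨t, ht⟩ := hC _ hpos y (hy.trans_lt hpos)
      refine ⟨t • 1, Submodule.smul_mem _ _ (Submodule.mem_span_singleton_self _), ?_⟩
      rw [dist_eq_norm]
      refine ht.trans_lt ?_
      rw [div_mul_eq_mul_div, div_lt_iff₀ (by positivity)]
      exact mul_lt_mul_of_pos_left ((le_abs_self C).trans_lt (lt_add_one _)) hδ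
    have hcl := (Submodule.closed_of_finiteDimensional
      (Submodule.span ℝ {(1 : Mat k)})).closure_eq
    rw [hcl] at hmem
    obtain ⟨t, ht⟩ := Submodule.mem_span_singleton.1 hmem
    exact ⟨t, Subtype.ext ht.symm⟩
  · rintro ⟨t, ht⟩
    refine le_antisymm ?_ (apply_nonneg (quotientSeminorm (hφ.onDomain LX) LX.L) y)
    have h0 : LX.L (t • LX.domain.unit) = 0 := (LX.isLipNorm.eq_zero_iff _).2 ⟨t, rfl⟩
    rw [← h0]
    refine quotientSeminorm_apply_le (hφ.onDomain LX) LX.L ?_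
    have hu : hφ.onDomain LX LX.domain.unit = 1 := hφ.toCLM_unit
    rw [map_smul, hu, ht]
    rfl
  · obtain ⟨t, ht⟩ := hC 2 two_pos y (hy.trans_lt one_lt_two)
    exact ⟨t, mem_closedBall_zero_iff.2 ht⟩

/-- The quotient Lip-norm on the image `φ(X) ⊆ M_k` of a u.c.p. map `φ`, with domain the image of
the domain of the given Lip-norm. -/
def LipNorm.range (LX : LipNorm X) (hφ : IsUCP φ) : LipNorm hφ.range where
  domain := hφ.rangeDomain LX
  domain_le := by
    rintro _ ⟨a, rfl⟩
    exact ⟨LX.incl a, rfl⟩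
  dense := by
    rintro _ ⟨x, rfl⟩ hx
    exact hφ.mem_closure_rangeDomain LX x hx
  L := quotientSeminorm (hφ.onDomain LX) LX.L
  isLipNorm := hφ.isLipNorm_quotientSeminorm LX
  isClosed_unitBall := isClosed_seminorm_unitBall _ _

end Range

/-! ### The Lip-norm on the direct sum -/

section Bridge

variable {A B : Type*}
  [CStarAlgebra A] [PartialOrder A] [StarOrderedRing A]
  [CStarAlgebra B] [PartialOrder B] [StarOrderedRing B]
  {X : OperatorSystem A} {Y : OperatorSystem B} {φ : X →ₗ[ℂ] Y}

/-- The order-unit space `𝒟(L_X) ⊕ 𝒟(L_Y)`. -/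
def prodDomain (LX : LipNorm X) (LY : LipNorm Y) : OrderUnitSubspace (A × B) where
  toSubmodule := LX.domain.toSubmodule.prod LY.domain.toSubmodule
  one_mem' := ⟨LX.domain.one_mem', LY.domain.one_mem'⟩
  isSelfAdjoint' _ ha :=
    Prod.ext (LX.domain.isSelfAdjoint' _ ha.1) (LY.domain.isSelfAdjoint' _ ha.2)

/-- The projection of `𝒟(L_X) ⊕ 𝒟(L_Y)` to `𝒟(L_X)`. -/
def prodDomainFst (LX : LipNorm X) (LY : LipNorm Y) : prodDomain LX LY →ₗ[ℝ] LX.domain where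
  toFun p := ⟨(p : A × B).1, p.2.1⟩
  map_add' _ _ := rfl
  map_smul' _ _ := rfl

/-- The projection of `𝒟(L_X) ⊕ 𝒟(L_Y)` to `𝒟(L_Y)`. -/
def prodDomainSnd (LX : LipNorm X) (LY : LipNorm Y) : prodDomain LX LY →ₗ[ℝ] LY.domain where
  toFun p := ⟨(p : A × B).2, p.2.2⟩
  map_add' _ _ := rfl
  map_smul' _ _ := rfl

/-- The seminorm `max (L_X(x), L_Y(y), ε⁻¹ ‖φ(x) - y‖)` on `𝒟(L_X) ⊕ 𝒟(L_Y)`. -/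
def bridgeSeminorm (LX : LipNorm X) (LY : LipNorm Y) (hφ : IsUCP φ) (ε : ℝ) :
    Seminorm ℝ (prodDomain LX LY) :=
  LX.L.comp (prodDomainFst LX LY) ⊔ LY.L.comp (prodDomainSnd LX LY) ⊔
    (normSeminorm ℝ B).comp (ε⁻¹ • (hφ.onDomain LX ∘ₗ prodDomainFst LX LY -
      LY.domain.toSubmodule.subtype ∘ₗ prodDomainSnd LX LY))

variable {LX : LipNorm X} {LY : LipNorm Y} (hφ : IsUCP φ) {ε : ℝ}

theorem bridgeSeminorm_le_iff (hε : 0 < ε) {p : prodDomain LX LY} {r : ℝ} :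
    bridgeSeminorm LX LY hφ ε p ≤ r ↔ LX.L (prodDomainFst LX LY p) ≤ r ∧
      LY.L (prodDomainSnd LX LY p) ≤ r ∧
        ‖hφ.onDomain LX (prodDomainFst LX LY p) - (p : A × B).2‖ ≤ ε * r := by
  have h : bridgeSeminorm LX LY hφ ε p = max (max (LX.L (prodDomainFst LX LY p))
      (LY.L (prodDomainSnd LX LY p)))
      ‖ε⁻¹ • (hφ.onDomain LX (prodDomainFst LX LY p) - (p : A × B).2)‖ := rfl
  rw [h, max_le_iff, max_le_iff, norm_smul, Real.norm_of_nonneg (inv_nonneg.2 hε.le),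
    inv_mul_le_iff₀ hε, and_assoc]

theorem bridgeSeminorm_eq_zero_iff [Nontrivial B] (hε : 0 < ε) (p : prodDomain LX LY) :
    bridgeSeminorm LX LY hφ ε p = 0 ↔ ∃ t : ℝ, p = t • (prodDomain LX LY).unit := by
  have hu : hφ.onDomain LX LX.domain.unit = 1 := hφ.toCLM_unit
  rw [← (apply_nonneg (bridgeSeminorm LX LY hφ ε) p).ge_iff_eq', bridgeSeminorm_le_iff hφ hε,
    mul_zero, norm_le_zero_iff, (apply_nonneg LX.L _).ge_iff_eq', (apply_nonneg LY.L _).ge_iff_eq',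
    LX.isLipNorm.eq_zero_iff, LY.isLipNorm.eq_zero_iff]
  constructor
  · rintro ⟨⟨t, ht⟩, ⟨s, hs⟩, h⟩
    have hs' : (p : A × B).2 = s • (1 : B) := congrArg Subtype.val hs
    rw [ht, map_smul, hu, hs', ← sub_smul] at h
    have hts := (smul_eq_zero.1 h).resolve_right one_ne_zero
    obtain rfl := sub_eq_zero.1 hts
    exact ⟨t, Subtype.ext (Prod.ext (congrArg Subtype.val ht) hs')⟩
  · rintro ⟨t, rfl⟩
    refine ⟨⟨t, rfl⟩, ⟨t, rfl⟩, ?_⟩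
    have h : prodDomainFst LX LY (t • (prodDomain LX LY).unit) = t • LX.domain.unit := rfl
    rw [h, map_smul, hu]
    exact sub_self _

/-- If `L(x, y) ≤ 1` and `x - t 1` lies in a bounded set, then so does `y - t 1`, as it is within `ε`
of `φ(x - t 1)`. -/
theorem isLipNorm_bridgeSeminorm [Nontrivial A] [Nontrivial B] [ProperSpace B] (hε : 0 < ε) :
    (prodDomain LX LY).IsLipNorm (bridgeSeminorm LX LY hφ ε) := by
  obtain ⟨K, hK, hLK⟩ := LX.isLipNorm.exists_totallyBounded
  obtain ⟨C, hC⟩ := hK.isBounded.exists_norm_le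
  refine OrderUnitSubspace.isLipNorm_of_totallyBounded (bridgeSeminorm_eq_zero_iff hφ hε)
    ((hK.closure.isCompact_of_isClosed isClosed_closure).prod
      (isCompact_closedBall (0 : B) (ε + C))).totallyBounded fun p hp => ?_
  obtain ⟨h₁, -, h₃⟩ := (bridgeSeminorm_le_iff hφ hε).1 hp
  obtain ⟨t, ht⟩ := hLK _ h₁
  refine ⟨t, subset_closure ht, mem_closedBall_zero_iff.2 ?_⟩
  have h₄ := (hφ.norm_onDomain_sub_smul_le LX (prodDomainFst LX LY p) t).trans (hC _ ht)
  rw [mul_one, norm_sub_rev] at h₃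
  have h₅ := norm_add_le ((p : A × B).2 - hφ.onDomain LX (prodDomainFst LX LY p))
    (hφ.onDomain LX (prodDomainFst LX LY p) - t • (1 : B))
  rw [sub_add_sub_cancel] at h₅
  exact h₅.trans (add_le_add h₃ h₄)

theorem isClosed_bridgeSeminorm_unitBall (hε : 0 < ε) :
    IsClosed {a : A × B | ∃ d : prodDomain LX LY, (d : A × B) = a ∧
      bridgeSeminorm LX LY hφ ε d ≤ 1} := by
  have hX : IsClosed (X.toSubmodule : Set A) := X.isClosed'
  let S : Set (X × B) := {q | (∃ d : LX.domain, (d : A) = q.1 ∧ LX.L d ≤ 1) ∧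
    (∃ d : LY.domain, (d : B) = q.2 ∧ LY.L d ≤ 1) ∧ ‖hφ.toCLM q.1 - q.2‖ ≤ ε}
  have hS : IsClosed S := by
    have hc : Continuous fun q : X × B => ‖hφ.toCLM q.1 - q.2‖ :=
      ((hφ.toCLM.continuous.comp continuous_fst).sub continuous_snd).norm
    have h : IsClosed {q : X × B | ‖hφ.toCLM q.1 - q.2‖ ≤ ε} := isClosed_le hc continuous_const
    exact (LX.isClosed_unitBall.preimage (continuous_subtype_val.comp continuous_fst)).inter
      ((LY.isClosed_unitBall.preimage continuous_snd).inter h)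
  have hemb : Topology.IsClosedEmbedding (Prod.map ((↑) : X → A) (id : B → B)) :=
    hX.isClosedEmbedding_subtypeVal.prodMap Topology.IsClosedEmbedding.id
  convert hemb.isClosedMap S hS using 1
  ext a
  constructor
  · rintro ⟨d, rfl, hd⟩
    obtain ⟨h₁, h₂, h₃⟩ := (bridgeSeminorm_le_iff hφ hε).1 hd
    rw [mul_one] at h₃
    exact ⟨(LX.incl (prodDomainFst LX LY d), (d : A × B).2),
      ⟨⟨_, rfl, h₁⟩, ⟨_, rfl, h₂⟩, h₃⟩, rfl⟩
  · rintro ⟨⟨⟨x, hx⟩, y⟩, ⟨⟨d, rfl, hd⟩, ⟨e, rfl, he⟩, h⟩, rfl⟩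
    refine ⟨⟨(d, e), d.2, e.2⟩, rfl, (bridgeSeminorm_le_iff hφ hε).2 ⟨hd, he, ?_⟩⟩
    rw [mul_one]
    exact h

/-- The Lip-norm `max (L_X(x), L_Y(y), ε⁻¹ ‖φ(x) - y‖)` on `X ⊕ Y`. -/
def bridge [Nontrivial A] [Nontrivial B] [ProperSpace B] (LX : LipNorm X) (LY : LipNorm Y)
    (hφ : IsUCP φ) (hε : 0 < ε) : LipNorm (X.prod Y) where
  domain := prodDomain LX LY
  domain_le a ha := ⟨LX.domain_le _ ha.1, LY.domain_le _ ha.2⟩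
  dense a ha hsa := by
    have h : a ∈ closure (LX.domain.carrier ×ˢ LY.domain.carrier) := by
      rw [closure_prod_eq]
      exact ⟨LX.dense _ ha.1 (congrArg Prod.fst hsa), LY.dense _ ha.2 (congrArg Prod.snd hsa)⟩
    exact h
  L := bridgeSeminorm LX LY hφ ε
  isLipNorm := isLipNorm_bridgeSeminorm hφ hε
  isClosed_unitBall := isClosed_bridgeSeminorm_unitBall hφ hε

/-- If `L_Y` is the quotient of `L_X` along `φ`, then the bridge Lip-norm induces `L_X` and `L_Y`:
a pair `(x, φ(x))` realizes the infimum for `x`, and such pairs, with `φ(x) = y` and `L_X(x)` close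
to `L_Y(y)`, approach the infimum for `y`. -/
theorem bridge_induces [Nontrivial A] [Nontrivial B] [ProperSpace B] (hε : 0 < ε)
    (h₁ : ∀ x : LX.domain, ∃ y : LY.domain, hφ.onDomain LX x = y ∧ LY.L y ≤ LX.L x)
    (h₂ : ∀ (y : LY.domain) (r : ℝ), LY.L y < r →
      ∃ x : LX.domain, hφ.onDomain LX x = y ∧ LX.L x < r) :
    (bridge LX LY hφ hε).Induces LX LY where
  mem_domain_iff _ := Iff.rfl
  fst x := by
    constructor
    · rintro _ ⟨p, hp, rfl⟩
      have h := ((bridgeSeminorm_le_iff hφ hε).1 (le_refl (bridgeSeminorm LX LY hφ ε p))).1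
      have hx : prodDomainFst LX LY p = x := Subtype.ext hp
      rwa [hx] at h
    · intro r hr
      obtain ⟨y, hxy, hy⟩ := h₁ x
      refine (hr ⟨⟨((x : A), (y : B)), x.2, y.2⟩, rfl, rfl⟩).trans ?_
      refine (bridgeSeminorm_le_iff hφ hε).2 ⟨le_rfl, hy, ?_⟩
      have h : ‖hφ.onDomain LX x - y‖ ≤ ε * LX.L x := by
        rw [hxy, sub_self, norm_zero]
        exact mul_nonneg hε.le (apply_nonneg _ _)
      exact h
  snd y := by
    constructor
    · rintro _ ⟨p, hp, rfl⟩
      have h := ((bridgeSeminorm_le_iff hφ hε).1 (le_refl (bridgeSeminorm LX LY hφ ε p))).2.1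
      have hy : prodDomainSnd LX LY p = y := Subtype.ext hp
      rwa [hy] at h
    · intro r hr
      refine le_of_forall_gt_imp_ge_of_dense fun s hs => ?_
      obtain ⟨x, hxy, hx⟩ := h₂ y s hs
      refine (hr ⟨⟨((x : A), (y : B)), x.2, y.2⟩, rfl, rfl⟩).trans ?_
      refine (bridgeSeminorm_le_iff hφ hε).2 ⟨hx.le, hs.le, ?_⟩
      have h : ‖hφ.onDomain LX x - y‖ ≤ ε * s := by
        rw [hxy, sub_self, norm_zero]
        exact mul_nonneg hε.le ((apply_nonneg LY.L y).trans hs.le)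
      exact h

/-- If `γ ∘ φ` moves the elements of the Lipschitz ball by at most `ε`, then composition with `φ`
and with `γ` moves matrix states by at most `2ε`: for `L(x, y) ≤ 1` both `‖φ(x) - y‖ ≤ ε` and
`‖x - γ(y)‖ ≤ ‖x - γ(φ(x))‖ + ‖γ(φ(x) - y)‖ ≤ 2ε`. -/
theorem hausdorffDist_bridge_le [Nontrivial A] [Nontrivial B] [ProperSpace B] (hε : 0 < ε)
    {γ : Y →ₗ[ℂ] X} (hγ : IsUCP γ)
    (h : ∀ x : LX.domain, LX.L x ≤ 1 → ‖(x : A) - γ (φ (LX.incl x))‖ ≤ ε) (n : ℕ) :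
    (bridge LX LY hφ hε).hausdorffDist n ≤ ENNReal.ofReal (2 * ε) := by
  let := (bridge LX LY hφ hε).rho n
  refine Metric.hausdorffEDist_le_of_mem_edist ?_ ?_
  · rintro _ ⟨ψ, rfl⟩
    refine ⟨_, ⟨⟨ψ.1 ∘ₗ γ, ψ.2.comp hγ⟩, rfl⟩, iSup₂_le fun p hp => ?_⟩
    obtain ⟨h₁, -, h₃⟩ := (bridgeSeminorm_le_iff hφ hε).1 hp
    rw [mul_one] at h₃
    let x : X := LX.incl (prodDomainFst LX LY p)
    let y : Y := LY.incl (prodDomainSnd LX LY p)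
    have hx : IsSelfAdjoint (x : A) := LX.domain.isSelfAdjoint' _ p.2.1
    have hy : IsSelfAdjoint (y : B) := LY.domain.isSelfAdjoint' _ p.2.2
    have h₄ : ‖((γ (φ x - y) : X) : A)‖ ≤ ε :=
      (hγ.norm_apply_le ((hφ.isSelfAdjoint_apply hx).sub hy)).trans h₃
    have h₅ : ‖((x - γ y : X) : A)‖ ≤ 2 * ε := by
      have h₆ := norm_add_le ((x : A) - γ (φ x)) (γ (φ x - y) : X)
      rw [map_sub, Submodule.coe_sub, sub_add_sub_cancel] at h₆
      rw [map_sub, Submodule.coe_sub] at h₄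
      rw [Submodule.coe_sub]
      have h₇ : ‖(x : A) - γ (φ x)‖ ≤ ε := h _ h₁
      linarith
    rw [← ofReal_norm]
    refine ENNReal.ofReal_le_ofReal ?_
    have h₇ := (ψ.2.norm_apply_le (x := x - γ y) (hx.sub (hγ.isSelfAdjoint_apply hy))).trans h₅
    rw [map_sub] at h₇
    exact h₇
  · rintro _ ⟨ψ, rfl⟩
    refine ⟨_, ⟨⟨ψ.1 ∘ₗ φ, ψ.2.comp hφ⟩, rfl⟩, iSup₂_le fun p hp => ?_⟩
    obtain ⟨-, -, h₃⟩ := (bridgeSeminorm_le_iff hφ hε).1 hp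
    rw [mul_one, norm_sub_rev] at h₃
    let x : X := LX.incl (prodDomainFst LX LY p)
    let y : Y := LY.incl (prodDomainSnd LX LY p)
    have hx : IsSelfAdjoint (x : A) := LX.domain.isSelfAdjoint' _ p.2.1
    have hy : IsSelfAdjoint (y : B) := LY.domain.isSelfAdjoint' _ p.2.2
    rw [← ofReal_norm]
    refine ENNReal.ofReal_le_ofReal ?_
    have h₇ := (ψ.2.norm_apply_le (x := y - φ x) (hy.sub (hφ.isSelfAdjoint_apply hx))).trans h₃
    rw [map_sub] at h₇
    exact h₇.trans (by linarith)

end Bridge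

/-! ### Approximation of the identity on the Lipschitz ball -/

section Nuclear

variable {A : Type*} [CStarAlgebra A] [PartialOrder A] [StarOrderedRing A] {X : OperatorSystem A}

theorem IsNuclear.exists_isUCP_forall_finite (hX : IsNuclear X) {F : Set X} (hF : F.Finite) {ε : ℝ}
    (hε : 0 < ε) : ∃ k : ℕ, 0 < k ∧
      ∃ (Φ : X →ₗ[ℂ] OperatorSystem.full (Mat k)) (Γ : OperatorSystem.full (Mat k) →ₗ[ℂ] X),
        IsUCP Φ ∧ IsUCP Γ ∧ ∀ x ∈ F, ‖x - Γ (Φ x)‖ < ε := by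
  obtain ⟨f, hf, k, hk, Φ, Γ, hΦ, hΓ, rfl⟩ := mem_closure_iff.1 hX
    (F.pi fun x => Metric.ball x ε) (isOpen_set_pi hF fun _ _ => Metric.isOpen_ball)
    fun x _ => Metric.mem_ball_self hε
  refine ⟨k, hk, Φ, Γ, hΦ, hΓ, fun x hx => ?_⟩
  have := hf x hx
  rwa [Metric.mem_ball, dist_comm, dist_eq_norm] at this

/-- A nuclear operator system is nonzero: the zero space has no unital map to `M_k` with `k > 0`. -/
theorem IsNuclear.nontrivial (hX : IsNuclear X) : Nontrivial A := by
  obtain ⟨k, hk, Φ, -, hΦ, -⟩ := hX.exists_isUCP_forall_finite Set.finite_empty one_pos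
  have : Nonempty (Fin k) := ⟨⟨0, hk⟩⟩
  refine ⟨1, 0, fun h => ?_⟩
  have h₁ : X.unit = 0 := Subtype.ext h
  have h₂ := hΦ.toCLM_unit
  rw [h₁, map_zero] at h₂
  exact zero_ne_one h₂

/-- By total boundedness modulo scalars, the point-norm approximation of the identity of a nuclear
operator system is uniform on the Lipschitz ball. -/
theorem IsNuclear.exists_isUCP_forall_lipschitzBall (hX : IsNuclear X) (LX : LipNorm X) {ε : ℝ}
    (hε : 0 < ε) : ∃ k : ℕ, 0 < k ∧
      ∃ (Φ : X →ₗ[ℂ] OperatorSystem.full (Mat k)) (Γ : OperatorSystem.full (Mat k) →ₗ[ℂ] X),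
        IsUCP Φ ∧ IsUCP Γ ∧
          ∀ x : LX.domain, LX.L x ≤ 1 → ‖(x : A) - Γ (Φ (LX.incl x))‖ ≤ ε := by
  have := hX.nontrivial
  obtain ⟨K, hK, hLK⟩ := LX.isLipNorm.exists_totallyBounded
  obtain ⟨F, hFS, hFf, hF⟩ := Metric.finite_approx_of_totallyBounded
    (totallyBounded_preimage (f := ((↑) : LX.domain → A)) (isUniformInducing_val _) hK) (ε / 3)
    (by positivity)
  obtain ⟨k, hk, Φ, Γ, hΦ, hΓ, h⟩ := hX.exists_isUCP_forall_finite (hFf.image LX.incl)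
    (show 0 < ε / 3 by positivity)
  refine ⟨k, hk, Φ, Γ, hΦ, hΓ, fun x hx => ?_⟩
  obtain ⟨t, ht⟩ := hLK x hx
  obtain ⟨b, hb, hab⟩ := Set.mem_iUnion₂.1
    (hF (show x - t • LX.domain.unit ∈ ((↑) : LX.domain → A) ⁻¹' K from ht))
  rw [Metric.mem_ball, dist_eq_norm] at hab
  have hbF := (h _ (Set.mem_image_of_mem _ hb)).le
  -- `x = z + t 1 + b` with `‖z‖ ≤ ε / 3` and `b ∈ F`, and `Γ ∘ Φ` fixes the unit.
  let z : LX.domain := x - t • LX.domain.unit - b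
  have hz : ‖(z : A)‖ ≤ ε / 3 := hab.le
  have hx' : LX.incl x = LX.incl z + t • X.unit + LX.incl b := by
    apply Subtype.ext
    change (x : A) = (x : A) - t • (1 : A) - b + t • (1 : A) + b
    abel
  have hΓΦ := hΓ.comp hΦ
  have hΓz := (hΓΦ.norm_apply_le (x := LX.incl z) (LX.domain.isSelfAdjoint' _ z.2)).trans hz
  have hΓu := hΓΦ.coe_map_smul_unit t
  have key : (x : A) - Γ (Φ (LX.incl x)) =
      ((z : A) - (Γ ∘ₗ Φ) (LX.incl z)) + ((b : A) - (Γ ∘ₗ Φ) (LX.incl b)) := by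
    have h₁ : ((Γ (Φ (LX.incl x)) : X) : A) = ((Γ ∘ₗ Φ) (LX.incl z) : X) + t • (1 : A) +
        ((Γ ∘ₗ Φ) (LX.incl b) : X) := by
      rw [← hΓu, ← Submodule.coe_add, ← Submodule.coe_add, ← map_add, ← map_add, ← hx']
      rfl
    have h₂ : (x : A) = (z : A) + t • (1 : A) + b := congrArg Subtype.val hx'
    rw [h₁, h₂]
    abel
  rw [key]
  refine (norm_add_le _ _).trans ?_
  have h₁ := norm_sub_le (z : A) ((Γ ∘ₗ Φ) (LX.incl z) : X)
  have h₂ : ‖(b : A) - ((Γ ∘ₗ Φ) (LX.incl b) : X)‖ ≤ ε / 3 := hbF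
  linarith

end Nuclear

end LipNormed
end

theorem mainTheorem9 {A : Type*} [CStarAlgebra A] [PartialOrder A] [StarOrderedRing A]
    (X : LipNormed.OperatorSystem A) (hX : LipNormed.IsNuclear X) (LX : LipNormed.LipNorm X)
    (ε : ℝ) (hε : 0 < ε) :
    ∃ (k : ℕ) (_ : 0 < k) (Y : LipNormed.OperatorSystem (LipNormed.Mat k))
      (LY : LipNormed.LipNorm Y),
      LipNormed.LipNorm.completeDist LX LY ≤ ENNReal.ofReal ε := by
  have := hX.nontrivial
  have hε2 : 0 < ε / 2 := by positivity
  obtain ⟨k, hk, Φ, Γ, hΦ, hΓ, h⟩ := hX.exists_isUCP_forall_lipschitzBall LX hε2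
  have : Nonempty (Fin k) := ⟨⟨0, hk⟩⟩
  have : ProperSpace (LipNormed.Mat k) := FiniteDimensional.proper ℝ _
  refine ⟨k, hk, hΦ.range, LX.range hΦ, ?_⟩
  have hΦ' := hΦ.isUCP_rangeRestrict
  refine iInf₂_le_of_le (LipNormed.bridge LX (LX.range hΦ) hΦ' hε2)
    (LipNormed.bridge_induces hΦ' hε2 ?_ ?_) (iSup₂_le fun n _ => ?_)
  · exact fun x => ⟨⟨hΦ.onDomain LX x, x, rfl⟩, rfl,
      LipNormed.quotientSeminorm_apply_le _ _ rfl⟩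
  · exact fun y r hr => LipNormed.exists_lt_of_quotientSeminorm_lt _ _ hr
  · have h₁ := LipNormed.hausdorffDist_bridge_le (LX := LX) (LY := LX.range hΦ) hΦ' hε2
      (hΓ.restrictMat hΦ.range) h n
    rwa [mul_div_cancel₀ ε two_ne_zero] at h₁
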